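/- Let $\mathbb K=\mathbb R$ or $\mathbb C$ and let "analytic" mean real analytic, respectively holomorphic. Let $M$ and $B$ be (Hausdorff, second countable) analytic manifolds. A *regular foliation of dimension $d$* on an open set $O$ is an analytic rank-$d$ subbundle of $TO$ whose sheaf of analytic sections is stable under the Lie bracket. A *deformation of foliations of dimension $n$* is a proper analytic submersion $\pi:M\to B$ together with a regular foliation $\mathcal F$ of dimension $n$ on $M$ with $\mathcal F\subset\ker d\pi$. *Integration.* A regular foliation $\mathcal H$ of dimension $h$ on an open set $W\subset B$ *integrates* the deformation if every $b\in W$ has an open neighborhood $U\subset W$ such that there is a regular foliation $\mathcal G$ of dimension $n+h$ on $\pi^{-1}(U)$ with $\mathcal F|_{\pi^{-1}(U)}\subset\mathcal G\subset\pi^*\mathcal H$ (where $(\pi^*\mathcal H)_x=(d_x\pi)^{-1}(\mathcal H_{\pi(x)})$) which projects onto $\mathcal H$, i.e. $d_x\pi(\mathcal G_x)=\mathcal H_{\pi(x)}$ for all $x\in\pi^{-1}(U)$. *Basic Kodaira–Spencer class.* An analytic vector field $v$ on an open subset of $M$ is *basic* if $[v,\mathcal F]\subset\mathcal F$; it is *projectable*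 onto a vector field $w$ of the base if $d\pi\circ v=w\circ\pi$, and *vertical* if $d\pi(v)=0$. Let $\mathcal B^0$ be the sheaf of basic vertical vector fields; it contains $\mathcal F$. If $w$ is an analytic vector field on an open set $W\subset B$, the basic Kodaira–Spencer class of $w$ over $W$ is the class $\partial\mathcal F(w)$ in the first Čech cohomology $H^1(\pi^{-1}(W),\mathcal B^0/\mathcal F)$ (cocycles over open coverings, modulo refinement and coboundaries) of the cocycle $(v_i-v_j)_{i,j}$, where $(U_i)$ is an open covering of $\pi^{-1}(W)$ and $v_i$ is a basic vector field on $U_i$ projectable onto $w$; it does not depend on the choices. It vanishes if and only if the covering and the $v_i$ can be chosen so that each difference $v_i-v_j$ is tangent to $\mathcal F$. We say that it vanishes at $\tau$ if it vanishes over some open neighborhood of $\tau$. **Proposition.** Let $(M,\mathcal F)\xrightarrow{\pi}B$ be a deformation of foliations, let $\tau\in B$, and let $w$ be an analytic vector field on an open neighborhood $W$ of $\tau$ with $w(\tau)\neq0$. Then the following are equivalent: 1. on some open neighborhood $W'\subset W$ of $\tau$, the line field spanned by $w$ is a regular foliation of dimension $1$ that integrates the deformation; 2. the basic Kodaira–Spencer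 class $\partial\mathcal F(w)$ vanishes at $\tau$. -/

import Mathlib

open TopologicalSpace VectorField
open scoped Manifold ContDiff

namespace FoliationDeformation

universe u v

set_option linter.unusedSectionVars false

noncomputable section

/-! ### First Čech cohomology of a quotient of sheaves of groups -/

/-- A presheaf of abelian groups of the form `O ↦ A(O) / T(O)`, where `T(O) ≤ A(O)` are groups of
elements of a fixed abelian group (here: vector fields, arbitrary outside of `O`), and where the
restriction maps are induced by the identity. -/
structure QuotientPresheaf (X : Type u) [TopologicalSpace X] (A : Type v) [AddCommGroup A] where
  num : Opens X → AddSubgroup A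
  den : Opens X → AddSubgroup A
  num_anti : ∀ {O O' : Opens X}, O' ≤ O → num O ≤ num O'
  den_anti : ∀ {O O' : Opens X}, O' ≤ O → den O ≤ den O'
  den_le : ∀ O, den O ≤ num O

variable {X : Type u} [TopologicalSpace X] {A : Type v} [AddCommGroup A]

/-- A Čech `1`-cocycle over the open set `P` with values in `Q = num / den`, for some open covering
of `P`. The values on `U i ⊓ U j` are given by representatives in `num (U i ⊓ U j)`. -/
structure CechCocycle (Q : QuotientPresheaf X A) (P : Opens X) where
  ι : Type u
  U : ι → Opens X
  cover : ⨆ i, U i = P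
  t : ι → ι → A
  mem : ∀ i j, t i j ∈ Q.num (U i ⊓ U j)
  cocycle : ∀ i j k, t i j + t j k - t i k ∈ Q.den (U i ⊓ U j ⊓ U k)

/-- Two Čech cocycles are cohomologous if, after restriction to some common refinement of their
coverings, they differ by the coboundary of a `0`-cochain. -/
def Cohomologous {Q : QuotientPresheaf X A} {P : Opens X} (s t : CechCocycle Q P) : Prop :=
  ∃ (κ : Type u) (V : κ → Opens X) (ρ : κ → s.ι) (σ : κ → t.ι) (c : κ → A),
    (⨆ k, V k = P) ∧ (∀ k, V k ≤ s.U (ρ k)) ∧ (∀ k, V k ≤ t.U (σ k)) ∧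
    (∀ k, c k ∈ Q.num (V k)) ∧
    ∀ k l, s.t (ρ k) (ρ l) - t.t (σ k) (σ l) - (c k - c l) ∈ Q.den (V k ⊓ V l)

theorem Cohomologous.refl {Q : QuotientPresheaf X A} {P : Opens X} (s : CechCocycle Q P) :
    Cohomologous s s :=
  ⟨s.ι, s.U, id, id, fun _ => 0, s.cover, fun _ => le_rfl, fun _ => le_rfl,
    fun _ => zero_mem _, fun k l => by simp⟩

theorem Cohomologous.symm {Q : QuotientPresheaf X A} {P : Opens X} {s t : CechCocycle Q P}
    (h : Cohomologous s t) : Cohomologous t s := by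
  obtain ⟨κ, V, ρ, σ, c, hV, h1, h2, hc, h⟩ := h
  refine ⟨κ, V, σ, ρ, fun k => -c k, hV, h2, h1, fun k => neg_mem (hc k), fun k l => ?_⟩
  have := neg_mem (h k l)
  convert this using 1
  module

theorem Cohomologous.trans {Q : QuotientPresheaf X A} {P : Opens X} {s t r : CechCocycle Q P}
    (h : Cohomologous s t) (h' : Cohomologous t r) : Cohomologous s r := by
  obtain ⟨κ, V, ρ, σ, c, hV, h1, h2, hc, h⟩ := h
  obtain ⟨κ', V', ρ', σ', c', hV', h1', h2', hc', h'⟩ := h'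
  refine ⟨κ × κ', fun k => V k.1 ⊓ V' k.2, fun k => ρ k.1, fun k => σ' k.2,
    fun k => c k.1 + c' k.2 + t.t (σ k.1) (ρ' k.2), ?_, fun k => inf_le_left.trans (h1 _),
    fun k => inf_le_right.trans (h2' _), fun k => ?_, fun k l => ?_⟩
  · rw [iSup_prod]
    simp only [← inf_iSup_eq, hV', ← iSup_inf_eq, hV, inf_idem]
  · exact add_mem (add_mem (Q.num_anti inf_le_left (hc _)) (Q.num_anti inf_le_right (hc' _)))
      (Q.num_anti (inf_le_inf (h2 _) (h1' _)) (t.mem _ _))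
  · have hk : V k.1 ⊓ V' k.2 ⊓ (V l.1 ⊓ V' l.2) ≤ V k.1 ⊓ V l.1 :=
      inf_le_inf inf_le_left inf_le_left
    have hl : V k.1 ⊓ V' k.2 ⊓ (V l.1 ⊓ V' l.2) ≤ V' k.2 ⊓ V' l.2 :=
      inf_le_inf inf_le_right inf_le_right
    have e1 := Q.den_anti hk (h k.1 l.1)
    have e2 := Q.den_anti hl (h' k.2 l.2)
    have e3 := Q.den_anti (O' := V k.1 ⊓ V' k.2 ⊓ (V l.1 ⊓ V' l.2))
      (le_inf (le_inf ((hk.trans inf_le_left).trans (h2 _)) ((hk.trans inf_le_right).trans (h2 _)))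
        ((hl.trans inf_le_right).trans (h1' _))) (t.cocycle (σ k.1) (σ l.1) (ρ' l.2))
    have e4 := Q.den_anti (O' := V k.1 ⊓ V' k.2 ⊓ (V l.1 ⊓ V' l.2))
      (le_inf (le_inf ((hk.trans inf_le_left).trans (h2 _)) ((hl.trans inf_le_left).trans (h1' _)))
        ((hl.trans inf_le_right).trans (h1' _))) (t.cocycle (σ k.1) (ρ' k.2) (ρ' l.2))
    convert sub_mem (add_mem (add_mem e1 e2) e3) e4 using 1
    module

instance cechSetoid (Q : QuotientPresheaf X A) (P : Opens X) : Setoid (CechCocycle Q P) where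
  r := Cohomologous
  iseqv := ⟨Cohomologous.refl, Cohomologous.symm, Cohomologous.trans⟩

/-- The first Čech cohomology `H¹(P, num / den)`: cocycles over arbitrary open coverings of `P`,
modulo refinement and coboundaries. -/
def CechH1 (Q : QuotientPresheaf X A) (P : Opens X) : Type (max (u + 1) v) :=
  Quotient (cechSetoid Q P)

/-- The zero cocycle for the covering of `P` by itself. -/
def zeroCocycle (Q : QuotientPresheaf X A) (P : Opens X) : CechCocycle Q P where
  ι := PUnit
  U := fun _ => P
  cover := by simp
  t := fun _ _ => 0
  mem := fun _ _ => zero_mem _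
  cocycle := fun _ _ _ => by simp

instance (Q : QuotientPresheaf X A) (P : Opens X) : Zero (CechH1 Q P) :=
  ⟨Quotient.mk _ (zeroCocycle Q P)⟩

/-! ### Vector fields and foliations -/

section Foliations

variable {𝕜 : Type*} [RCLike 𝕜] {E : Type*} [NormedAddCommGroup E] [NormedSpace 𝕜 E]
  [FiniteDimensional 𝕜 E]
  {M : Type u} [TopologicalSpace M] [ChartedSpace E M] [IsManifold 𝓘(𝕜, E) ω M]

/-- The vector field `Y` is analytic on the open set `O`. -/
def IsAnalyticOn (O : Opens M) (Y : (x : M) → TangentSpace 𝓘(𝕜, E) x) : Prop :=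
  ContMDiffOn 𝓘(𝕜, E) 𝓘(𝕜, E).tangent ω (fun x => (Y x : TangentBundle 𝓘(𝕜, E) M)) O

/-- `Y` is an analytic section over `O` of the field of tangent subspaces `F`. -/
def IsSection (F : (x : M) → Submodule 𝕜 (TangentSpace 𝓘(𝕜, E) x)) (O : Opens M)
    (Y : (x : M) → TangentSpace 𝓘(𝕜, E) x) : Prop :=
  IsAnalyticOn O Y ∧ ∀ x ∈ O, Y x ∈ F x

/-- `F` is a regular analytic foliation of dimension `d` on the open set `O`: an analytic
subbundle of rank `d` of the tangent bundle whose sections are stable under the Lie bracket.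
The values of `F` outside of `O` play no role. -/
structure IsRegularFoliation (O : Opens M) (F : (x : M) → Submodule 𝕜 (TangentSpace 𝓘(𝕜, E) x))
    (d : ℕ) : Prop where
  frame : ∀ x ∈ O, ∃ V : Opens M, x ∈ V ∧ V ≤ O ∧
    ∃ e : Fin d → (y : M) → TangentSpace 𝓘(𝕜, E) y, (∀ i, IsAnalyticOn V (e i)) ∧
      ∀ y ∈ V, LinearIndependent 𝕜 (fun i => e i y) ∧
        Submodule.span 𝕜 (Set.range fun i => e i y) = F y
  involutive : ∀ V : Opens M, V ≤ O → ∀ Y Z : (x : M) → TangentSpace 𝓘(𝕜, E) x,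
    IsSection F V Y → IsSection F V Z → ∀ x ∈ V, mlieBracket 𝓘(𝕜, E) Y Z x ∈ F x

/-- The analytic vector field `v` on `O` is basic for `F`, i.e. `[v, F] ⊆ F` (as sheaves). -/
def IsBasic (F : (x : M) → Submodule 𝕜 (TangentSpace 𝓘(𝕜, E) x)) (O : Opens M)
    (v : (x : M) → TangentSpace 𝓘(𝕜, E) x) : Prop :=
  IsAnalyticOn O v ∧ ∀ V : Opens M, V ≤ O → ∀ Y : (x : M) → TangentSpace 𝓘(𝕜, E) x,
    IsSection F V Y → ∀ x ∈ V, mlieBracket 𝓘(𝕜, E) v Y x ∈ F x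

/-- The field of lines spanned by a vector field. -/
def lineField (w : (x : M) → TangentSpace 𝓘(𝕜, E) x) (x : M) :
    Submodule 𝕜 (TangentSpace 𝓘(𝕜, E) x) :=
  Submodule.span 𝕜 {w x}

theorem IsAnalyticOn.mono {O O' : Opens M} (h : O' ≤ O) {Y : (x : M) → TangentSpace 𝓘(𝕜, E) x}
    (hY : IsAnalyticOn O Y) : IsAnalyticOn O' Y :=
  ContMDiffOn.mono hY h

theorem IsAnalyticOn.mdifferentiableAt {O : Opens M} {Y : (x : M) → TangentSpace 𝓘(𝕜, E) x}
    (hY : IsAnalyticOn O Y) {x : M} (hx : x ∈ O) :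
    MDifferentiableAt 𝓘(𝕜, E) 𝓘(𝕜, E).tangent
      (fun x => (Y x : TangentBundle 𝓘(𝕜, E) M)) x :=
  (ContMDiffOn.contMDiffAt hY (O.isOpen.mem_nhds hx)).mdifferentiableAt (by simp)

theorem IsAnalyticOn.zero (O : Opens M) :
    IsAnalyticOn O (0 : (x : M) → TangentSpace 𝓘(𝕜, E) x) :=
  (Bundle.contMDiff_zeroSection 𝕜 (TangentSpace 𝓘(𝕜, E) : M → Type _)).contMDiffOn

theorem IsAnalyticOn.add {O : Opens M} {Y Z : (x : M) → TangentSpace 𝓘(𝕜, E) x}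
    (hY : IsAnalyticOn O Y) (hZ : IsAnalyticOn O Z) : IsAnalyticOn O (Y + Z) :=
  ContMDiffOn.add_section hY hZ

theorem IsAnalyticOn.neg {O : Opens M} {Y : (x : M) → TangentSpace 𝓘(𝕜, E) x}
    (hY : IsAnalyticOn O Y) : IsAnalyticOn O (-Y) :=
  ContMDiffOn.neg_section hY

theorem IsBasic.add {F : (x : M) → Submodule 𝕜 (TangentSpace 𝓘(𝕜, E) x)} {O : Opens M}
    {v v' : (x : M) → TangentSpace 𝓘(𝕜, E) x} (h : IsBasic F O v) (h' : IsBasic F O v') :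
    IsBasic F O (v + v') :=
  ⟨h.1.add h'.1, fun V hV Y hY x hx => by
    have := FiniteDimensional.complete 𝕜 E
    rw [mlieBracket_add_left (h.1.mdifferentiableAt (hV hx)) (h'.1.mdifferentiableAt (hV hx))]
    exact add_mem (h.2 V hV Y hY x hx) (h'.2 V hV Y hY x hx)⟩

theorem IsBasic.neg {F : (x : M) → Submodule 𝕜 (TangentSpace 𝓘(𝕜, E) x)} {O : Opens M}
    {v : (x : M) → TangentSpace 𝓘(𝕜, E) x} (h : IsBasic F O v) : IsBasic F O (-v) :=
  ⟨h.1.neg, fun V hV Y hY x hx => by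
    have := FiniteDimensional.complete 𝕜 E
    have : -v = (-1 : 𝕜) • v := by simp
    rw [this, mlieBracket_const_smul_left (h.1.mdifferentiableAt (hV hx))]
    exact Submodule.smul_mem _ _ (h.2 V hV Y hY x hx)⟩

theorem IsBasic.zero (F : (x : M) → Submodule 𝕜 (TangentSpace 𝓘(𝕜, E) x)) (O : Opens M) :
    IsBasic F O 0 :=
  ⟨IsAnalyticOn.zero O, fun V _ Y _ x _ => by
    rw [mlieBracket_zero_left]; exact zero_mem _⟩

theorem IsBasic.mono {F : (x : M) → Submodule 𝕜 (TangentSpace 𝓘(𝕜, E) x)} {O O' : Opens M}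
    (hO : O' ≤ O) {v : (x : M) → TangentSpace 𝓘(𝕜, E) x} (h : IsBasic F O v) :
    IsBasic F O' v :=
  ⟨h.1.mono hO, fun V hV => h.2 V (hV.trans hO)⟩

end Foliations

/-! ### Deformations of foliations -/

section Deformations

variable (𝕜 : Type*) [RCLike 𝕜]
  {E : Type*} [NormedAddCommGroup E] [NormedSpace 𝕜 E]
  [FiniteDimensional 𝕜 E]
  {E' : Type*} [NormedAddCommGroup E'] [NormedSpace 𝕜 E']
  [FiniteDimensional 𝕜 E']
  (M : Type u) [TopologicalSpace M] [ChartedSpace E M] [IsManifold 𝓘(𝕜, E) ω M]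
  (B : Type v) [TopologicalSpace B] [ChartedSpace E' B] [IsManifold 𝓘(𝕜, E') ω B]

/-- A deformation of regular foliations of dimension `n`: a proper analytic submersion
`π : M → B` and a regular foliation of dimension `n` on `M` tangent to the fibers of `π`. -/
structure Deformation (n : ℕ) where
  π : M → B
  analytic : ContMDiff 𝓘(𝕜, E) 𝓘(𝕜, E') ω π
  proper : IsProperMap π
  submersion : ∀ x, Function.Surjective (mfderiv 𝓘(𝕜, E) 𝓘(𝕜, E') π x)
  F : (x : M) → Submodule 𝕜 (TangentSpace 𝓘(𝕜, E) x)
  isFoliation : IsRegularFoliation ⊤ F n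
  tangent : ∀ x, ∀ v ∈ F x, mfderiv 𝓘(𝕜, E) 𝓘(𝕜, E') π x v = 0

variable {𝕜 M B} {n : ℕ}

namespace Deformation

variable (D : Deformation 𝕜 (E := E) (E' := E') M B n)

/-- The open set `π⁻¹(W)`. -/
def preim (W : Opens B) : Opens M := ⟨D.π ⁻¹' W, W.isOpen.preimage D.analytic.continuous⟩

/-- The foliation `H`, regular of dimension `h` on the open set `W` of the base, integrates the
deformation (over `W`): near each point of `W` there is a regular foliation `G` on `π⁻¹(U)`, of
dimension `n + h`, with `F ⊆ G ⊆ π^*H`, which projects onto `H`. -/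
def IsIntegratedBy (W : Opens B) (H : (b : B) → Submodule 𝕜 (TangentSpace 𝓘(𝕜, E') b))
    (h : ℕ) : Prop :=
  IsRegularFoliation W H h ∧ ∀ b ∈ W, ∃ U : Opens B, b ∈ U ∧ U ≤ W ∧
    ∃ G : (x : M) → Submodule 𝕜 (TangentSpace 𝓘(𝕜, E) x),
      IsRegularFoliation (D.preim U) G (n + h) ∧ ∀ x ∈ D.preim U, D.F x ≤ G x ∧
        (∀ v ∈ G x, mfderiv 𝓘(𝕜, E) 𝓘(𝕜, E') D.π x v ∈ H (D.π x)) ∧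
        (∀ η ∈ H (D.π x), ∃ v ∈ G x, mfderiv 𝓘(𝕜, E) 𝓘(𝕜, E') D.π x v = η)

/-- `v` is, over the open set `O` of `M`, projectable onto the vector field `w` of the base. -/
def ProjectsTo (O : Opens M) (v : (x : M) → TangentSpace 𝓘(𝕜, E) x)
    (w : (b : B) → TangentSpace 𝓘(𝕜, E') b) : Prop :=
  ∀ x ∈ O, mfderiv 𝓘(𝕜, E) 𝓘(𝕜, E') D.π x (v x) = w (D.π x)

/-- The basic vertical vector fields on `O`. -/
def basicVertical (O : Opens M) : AddSubgroup ((x : M) → TangentSpace 𝓘(𝕜, E) x) where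
  carrier := {v | IsBasic D.F O v ∧ D.ProjectsTo O v 0}
  zero_mem' := ⟨IsBasic.zero _ _, fun x _ => map_zero _⟩
  add_mem' := fun {v v'} h h' => ⟨h.1.add h'.1, fun x hx => by
    have e1 := h.2 x hx
    have e2 := h'.2 x hx
    rw [Pi.add_apply, map_add, e1, e2]; simp⟩
  neg_mem' := fun {v} h => ⟨h.1.neg, fun x hx => by
    have e1 := h.2 x hx
    rw [Pi.neg_apply, map_neg, e1]; simp⟩

/-- The vector fields on `O` tangent to the foliation. -/
def tangentFields (O : Opens M) : AddSubgroup ((x : M) → TangentSpace 𝓘(𝕜, E) x) where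
  carrier := {v | IsSection D.F O v}
  zero_mem' := ⟨IsAnalyticOn.zero O, fun _ _ => zero_mem _⟩
  add_mem' := fun h h' => ⟨h.1.add h'.1, fun x hx => add_mem (h.2 x hx) (h'.2 x hx)⟩
  neg_mem' := fun h => ⟨h.1.neg, fun x hx => neg_mem (h.2 x hx)⟩

/-- The quotient of the sheaf of basic vertical vector fields by the foliation. -/
def basicNormal : QuotientPresheaf M ((x : M) → TangentSpace 𝓘(𝕜, E) x) where
  num := D.basicVertical
  den := D.tangentFields
  num_anti := fun h _ hv => ⟨hv.1.mono h, fun x hx => hv.2 x (h hx)⟩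
  den_anti := fun h _ hv => ⟨hv.1.mono h, fun x hx => hv.2 x (h hx)⟩
  den_le := fun _ v hv => ⟨⟨hv.1, fun V hV Y hY =>
      D.isFoliation.involutive V le_top v Y ⟨hv.1.mono hV, fun x hx => hv.2 x (hV hx)⟩ hY⟩,
    fun x hx => D.tangent x _ (hv.2 x hx)⟩

/-- An open covering of `π⁻¹(W)` together with, on each of its members, a basic projectable vector
field that projects onto `w`. -/
structure BasicLifts (w : (b : B) → TangentSpace 𝓘(𝕜, E') b) (W : Opens B) where
  ι : Type u
  U : ι → Opens M
  cover : ⨆ i, U i = D.preim W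
  v : ι → (x : M) → TangentSpace 𝓘(𝕜, E) x
  basic : ∀ i, IsBasic D.F (U i) (v i)
  projects : ∀ i, D.ProjectsTo (U i) (v i) w

variable {D} in
/-- The cocycle `(v i - v j)` of a family of basic lifts. -/
def BasicLifts.cocycle {w : (b : B) → TangentSpace 𝓘(𝕜, E') b} {W : Opens B}
    (L : D.BasicLifts w W) : CechCocycle D.basicNormal (D.preim W) where
  ι := L.ι
  U := L.U
  cover := L.cover
  t := fun i j => L.v i - L.v j
  mem := fun i j => by
    refine ⟨?_, fun x hx => ?_⟩
    · rw [sub_eq_add_neg]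
      exact ((L.basic i).mono inf_le_left).add ((L.basic j).mono inf_le_right).neg
    · have e1 := L.projects i x hx.1
      have e2 := L.projects j x hx.2
      rw [Pi.sub_apply, map_sub, e1, e2]; simp
  cocycle := fun i j k => by
    have : L.v i - L.v j + (L.v j - L.v k) - (L.v i - L.v k) = 0 := by abel
    rw [this]; exact zero_mem _

/-- `c` is the basic Kodaira–Spencer class of `w` over `W`, an element of
`H¹(π⁻¹(W), basic vertical fields / F)`. -/
def IsBasicKSClass (w : (b : B) → TangentSpace 𝓘(𝕜, E') b) (W : Opens B)
    (c : CechH1 D.basicNormal (D.preim W)) : Prop :=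
  ∃ L : D.BasicLifts w W, c = Quotient.mk _ L.cocycle

/-- The class does not depend on the choice of the lifts. -/
theorem IsBasicKSClass.unique {w : (b : B) → TangentSpace 𝓘(𝕜, E') b} {W : Opens B}
    {c c' : CechH1 D.basicNormal (D.preim W)} (h : D.IsBasicKSClass w W c)
    (h' : D.IsBasicKSClass w W c') : c = c' := by
  obtain ⟨L, rfl⟩ := h
  obtain ⟨L', rfl⟩ := h'
  refine Quotient.sound ⟨L.ι × L'.ι, fun k => L.U k.1 ⊓ L'.U k.2, Prod.fst, Prod.snd,
    fun k => L.v k.1 - L'.v k.2, ?_, fun _ => inf_le_left, fun _ => inf_le_right, fun k => ?_,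
    fun k l => ?_⟩
  · rw [iSup_prod]
    simp only [← inf_iSup_eq, L'.cover, ← iSup_inf_eq, L.cover, inf_idem]
  · beta_reduce
    refine ⟨?_, fun x hx => ?_⟩
    · rw [sub_eq_add_neg]
      exact ((L.basic k.1).mono inf_le_left).add ((L'.basic k.2).mono inf_le_right).neg
    · have e1 := L.projects k.1 x hx.1
      have e2 := L'.projects k.2 x hx.2
      rw [Pi.sub_apply, map_sub, e1, e2]; simp
  · have : L.cocycle.t k.1 l.1 - L'.cocycle.t k.2 l.2
        - (L.v k.1 - L'.v k.2 - (L.v l.1 - L'.v l.2)) = 0 := by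
      change L.v k.1 - L.v l.1 - (L'.v k.2 - L'.v l.2) - _ = 0
      abel
    rw [this]; exact zero_mem _

/-- The germ at `τ` of the basic Kodaira–Spencer class of `w`, a germ of section of the first
higher direct image sheaf, is zero: the class vanishes over some neighborhood of `τ`. The argument
`W` is the domain of `w`. -/
def BasicKSVanishesAt (w : (b : B) → TangentSpace 𝓘(𝕜, E') b) (W : Opens B) (τ : B) : Prop :=
  ∃ W' : Opens B, τ ∈ W' ∧ W' ≤ W ∧ D.IsBasicKSClass w W' 0

end Deformation

end Deformations

end

end FoliationDeformation

/-! Everything rests on the picture of an extension `G` of rank `n + 1` as `F` plus one transverse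
direction lying over `w`, near points where `w` does not vanish.

Suppose `G` integrates the line field. Since `G` projects onto a nonzero line, `G ∩ ker dπ` has rank
at most `n`; it contains `F`, hence equals `F` (`mem_F_of_vertical`). Rescaling an element of a
local frame of `G` gives local sections that project onto `w` (`exists_section_projectsTo`). Such a
section `v` is basic: for `Y` in `F`, the bracket `[v, Y]` lies in `G` by involutivity, and it
projects onto `[w, 0] = 0` because brackets respect `π`-related fields
(`mfderiv_mlieBracket_of_related`). Two such sections differ by a vertical section of `G`, that is,
by a section of `F`, so the cocycle is zero.

Conversely, if the class vanishes, correcting the lifts by a cochain of basic vertical fields makes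
them agree modulo `F`. The spaces `F + ⟨v i⟩` then glue to a subbundle of rank `n + 1`. It is
involutive by the Leibniz rule, because the `v i` are basic (`IsRegularFoliation.sup_span`). -/

namespace FoliationDeformation

universe u v

set_option linter.unusedSectionVars false

open Set Filter Topology

/-! ### Lie brackets of related vector fields, computed in charts. -/

section RelatedFields

variable {𝕜 : Type*} [RCLike 𝕜] {E : Type*} [NormedAddCommGroup E] [NormedSpace 𝕜 E]
  {E' : Type*} [NormedAddCommGroup E'] [NormedSpace 𝕜 E']
  {M : Type*} [TopologicalSpace M] [ChartedSpace E M] [IsManifold 𝓘(𝕜, E) ω M]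
  {B : Type*} [TopologicalSpace B] [ChartedSpace E' B] [IsManifold 𝓘(𝕜, E') ω B]

/-- The expression of a vector field in the chart at `x₀`. -/
noncomputable def chartField (x₀ : M) (V : (x : M) → TangentSpace 𝓘(𝕜, E) x) (z : E) : E :=
  mpullbackWithin 𝓘(𝕜, E) 𝓘(𝕜, E) (extChartAt 𝓘(𝕜, E) x₀).symm V (range 𝓘(𝕜, E)) z

/-- The preferred chart has the identity as derivative at its own centre, so the last pullback in
the definition of the bracket drops out. -/
theorem mlieBracket_eq_lieBracket_chartField (x₀ : M) (V W : (x : M) → TangentSpace 𝓘(𝕜, E) x) :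
    mlieBracket 𝓘(𝕜, E) V W x₀ =
      lieBracket 𝕜 (chartField x₀ V) (chartField x₀ W) (extChartAt 𝓘(𝕜, E) x₀ x₀) := by
  rw [← mlieBracketWithin_univ, mlieBracketWithin_apply, mfderiv_extChartAt_self]
  simp only [preimage_univ, univ_inter, modelWithCornersSelf_coe, range_id]
  erw [ContinuousLinearMap.inverse_id]
  unfold chartField
  simp only [modelWithCornersSelf_coe, range_id]
  exact congrFun (lieBracketWithin_univ (𝕜 := 𝕜) (E := E)) _

/-- Pulling back by the inverse chart is pushing forward by the chart, since the two derivatives are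
mutually inverse. -/
theorem chartField_eq (x₀ : M) (V : (x : M) → TangentSpace 𝓘(𝕜, E) x) {y : M}
    (hy : y ∈ (extChartAt 𝓘(𝕜, E) x₀).source) :
    chartField x₀ V (extChartAt 𝓘(𝕜, E) x₀ y) =
      mfderiv 𝓘(𝕜, E) 𝓘(𝕜, E) (extChartAt 𝓘(𝕜, E) x₀) y (V y) := by
  obtain ⟨z, hz, rfl⟩ : ∃ z ∈ (extChartAt 𝓘(𝕜, E) x₀).target, (extChartAt 𝓘(𝕜, E) x₀).symm z = y :=
    ⟨_, (extChartAt 𝓘(𝕜, E) x₀).map_source hy, (extChartAt 𝓘(𝕜, E) x₀).left_inv hy⟩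
  rw [(extChartAt 𝓘(𝕜, E) x₀).right_inv hz, chartField, mpullbackWithin_apply,
    ContinuousLinearMap.inverse_eq (mfderivWithin_extChartAt_symm_comp_mfderiv_extChartAt hz)
      (mfderiv_extChartAt_comp_mfderivWithin_extChartAt_symm hz)]

theorem differentiableAt_chartField [CompleteSpace E] {x₀ : M}
    {V : (x : M) → TangentSpace 𝓘(𝕜, E) x}
    (hV : MDifferentiableAt 𝓘(𝕜, E) 𝓘(𝕜, E).tangent
      (fun x => (V x : TangentBundle 𝓘(𝕜, E) M)) x₀) :
    DifferentiableAt 𝕜 (chartField x₀ V) (extChartAt 𝓘(𝕜, E) x₀ x₀) := by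
  have h := (mdifferentiableWithinAt_univ.2 hV).differentiableWithinAt_mpullbackWithin_vectorField
  rw [preimage_univ, univ_inter] at h
  have h2 := h.differentiableAt (by simp)
  exact h2

/-- The Lie bracket is compatible with related vector fields. -/
theorem mfderiv_mlieBracket_of_related [CompleteSpace E] [CompleteSpace E'] {π : M → B} {x₀ : M}
    (hπ : ContMDiff 𝓘(𝕜, E) 𝓘(𝕜, E') ω π)
    {V W : (x : M) → TangentSpace 𝓘(𝕜, E) x} {v w : (b : B) → TangentSpace 𝓘(𝕜, E') b}
    (hV : MDifferentiableAt 𝓘(𝕜, E) 𝓘(𝕜, E).tangent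
      (fun x => (V x : TangentBundle 𝓘(𝕜, E) M)) x₀)
    (hW : MDifferentiableAt 𝓘(𝕜, E) 𝓘(𝕜, E).tangent
      (fun x => (W x : TangentBundle 𝓘(𝕜, E) M)) x₀)
    (hv : MDifferentiableAt 𝓘(𝕜, E') 𝓘(𝕜, E').tangent
      (fun b => (v b : TangentBundle 𝓘(𝕜, E') B)) (π x₀))
    (hw : MDifferentiableAt 𝓘(𝕜, E') 𝓘(𝕜, E').tangent
      (fun b => (w b : TangentBundle 𝓘(𝕜, E') B)) (π x₀))
    (hVv : ∀ᶠ x in 𝓝 x₀, mfderiv 𝓘(𝕜, E) 𝓘(𝕜, E') π x (V x) = v (π x))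
    (hWw : ∀ᶠ x in 𝓝 x₀, mfderiv 𝓘(𝕜, E) 𝓘(𝕜, E') π x (W x) = w (π x)) :
    mfderiv 𝓘(𝕜, E) 𝓘(𝕜, E') π x₀ (mlieBracket 𝓘(𝕜, E) V W x₀) =
      mlieBracket 𝓘(𝕜, E') v w (π x₀) := by
  set z₀ := extChartAt 𝓘(𝕜, E) x₀ x₀ with hz₀
  set f : E → E' := writtenInExtChartAt 𝓘(𝕜, E) 𝓘(𝕜, E') x₀ π with hf
  have hfz : f z₀ = extChartAt 𝓘(𝕜, E') (π x₀) (π x₀) := by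
    simp [hf, hz₀, writtenInExtChartAt]
  have hfs : ContDiffAt 𝕜 ω f z₀ := by
    have := (contMDiffAt_iff.1 (hπ x₀)).2
    rw [modelWithCornersSelf_coe, range_id, contDiffWithinAt_univ] at this
    exact this
  have hfd : mfderiv 𝓘(𝕜, E) 𝓘(𝕜, E') π x₀ = fderiv 𝕜 f z₀ := by
    rw [((hπ x₀).mdifferentiableAt (by simp)).mfderiv, modelWithCornersSelf_coe, range_id,
      fderivWithin_univ]
  -- Relatedness read in charts, as an identity of germs so that it can be differentiated; it comes
  -- from the chain rule on both sides of `hcomp`.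
  have key : ∀ {V : (x : M) → TangentSpace 𝓘(𝕜, E) x} {v : (b : B) → TangentSpace 𝓘(𝕜, E') b},
      (∀ᶠ x in 𝓝 x₀, mfderiv 𝓘(𝕜, E) 𝓘(𝕜, E') π x (V x) = v (π x)) →
      (fun z => fderiv 𝕜 f z (chartField x₀ V z)) =ᶠ[𝓝 z₀] (chartField (π x₀) v) ∘ f := by
    intro V v h
    have hc : Tendsto (extChartAt 𝓘(𝕜, E) x₀).symm (𝓝 z₀) (𝓝 x₀) := by
      have := continuousAt_extChartAt_symm (I := 𝓘(𝕜, E)) x₀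
      rwa [ContinuousAt, extChartAt_to_inv] at this
    have hsrc : ∀ᶠ x in 𝓝 x₀, π x ∈ (extChartAt 𝓘(𝕜, E') (π x₀)).source :=
      hπ.continuous.continuousAt.eventually (extChartAt_source_mem_nhds (I := 𝓘(𝕜, E')) (π x₀))
    filter_upwards [hc.eventually h, hc.eventually hsrc,
      extChartAt_target_mem_nhds (I := 𝓘(𝕜, E)) x₀] with z h1 h2 h3
    set y := (extChartAt 𝓘(𝕜, E) x₀).symm z with hy
    have hys : y ∈ (extChartAt 𝓘(𝕜, E) x₀).source := (extChartAt 𝓘(𝕜, E) x₀).map_target h3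
    have hyz : extChartAt 𝓘(𝕜, E) x₀ y = z := (extChartAt 𝓘(𝕜, E) x₀).right_inv h3
    have hχ : MDifferentiableAt 𝓘(𝕜, E) 𝓘(𝕜, E) (extChartAt 𝓘(𝕜, E) x₀) y :=
      mdifferentiableAt_extChartAt (by simpa using hys)
    have hχB : MDifferentiableAt 𝓘(𝕜, E') 𝓘(𝕜, E') (extChartAt 𝓘(𝕜, E') (π x₀)) (π y) :=
      mdifferentiableAt_extChartAt (by simpa using h2)
    have hπy : MDifferentiableAt 𝓘(𝕜, E) 𝓘(𝕜, E') π y := (hπ y).mdifferentiableAt (by simp)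
    have hfz : MDifferentiableAt 𝓘(𝕜, E) 𝓘(𝕜, E') f (extChartAt 𝓘(𝕜, E) x₀ y) := by
      rw [hyz]
      have h := (mdifferentiableWithinAt_extChartAt_symm (I := 𝓘(𝕜, E)) h3)
      rw [modelWithCornersSelf_coe, range_id, mdifferentiableWithinAt_univ] at h
      exact (hχB.comp y hπy).comp z h
    have hcomp : f ∘ extChartAt 𝓘(𝕜, E) x₀ =ᶠ[𝓝 y] extChartAt 𝓘(𝕜, E') (π x₀) ∘ π := by
      filter_upwards [(isOpen_extChartAt_source (I := 𝓘(𝕜, E)) x₀).mem_nhds hys] with y' hy'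
      simp only [hf, writtenInExtChartAt, Function.comp_apply,
        (extChartAt 𝓘(𝕜, E) x₀).left_inv hy']
    have hD := hcomp.mfderiv_eq (I := 𝓘(𝕜, E)) (I' := 𝓘(𝕜, E'))
    rw [mfderiv_comp y hfz hχ, mfderiv_comp y hχB hπy, mfderiv_eq_fderiv] at hD
    have hD' := congrArg (fun L => L (V y)) hD
    have e : (chartField (π x₀) v ∘ f) z =
        mfderiv 𝓘(𝕜, E') 𝓘(𝕜, E') (extChartAt 𝓘(𝕜, E') (π x₀)) (π y) (v (π y)) :=
      chartField_eq _ _ h2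
    have e' := chartField_eq x₀ V hys
    rw [hyz] at e' hD'
    rw [e, ← h1, e']
    exact hD'
  rw [mlieBracket_eq_lieBracket_chartField, mlieBracket_eq_lieBracket_chartField, hfd, ← hz₀,
    ← hfz]
  have hV' := differentiableAt_chartField hV
  have hW' := differentiableAt_chartField hW
  have hv' := differentiableAt_chartField hv
  have hw' := differentiableAt_chartField hw
  rw [← hfz] at hv' hw'
  have hfdiff : DifferentiableAt 𝕜 f z₀ := hfs.differentiableAt (by simp)
  have e1 := (key hVv).self_of_nhds
  have e2 := (key hWw).self_of_nhds
  -- The second derivatives of `f` cancel by symmetry. What remains are derivatives of the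
  -- pushed-forward fields, which `key` and the chain rule turn into the bracket on the base.
  refine (fderiv_apply_lieBracket hfs (by simp) hW' hV').trans ?_
  rw [(key hVv).fderiv_eq, (key hWw).fderiv_eq, fderiv_comp _ hv' hfdiff, fderiv_comp _ hw' hfdiff,
    ContinuousLinearMap.comp_apply, ContinuousLinearMap.comp_apply]
  exact congrArg₂ (fun a b => fderiv 𝕜 (chartField (π x₀) w) (f z₀) a -
    fderiv 𝕜 (chartField (π x₀) v) (f z₀) b) e1 e2

end RelatedFields

/-! ### Analytic coefficients along a nonvanishing field. -/

section Coefficients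

variable {𝕜 : Type*} [RCLike 𝕜] {E : Type*} [NormedAddCommGroup E] [NormedSpace 𝕜 E]
  {E' : Type*} [NormedAddCommGroup E'] [NormedSpace 𝕜 E']
  {M : Type*} [TopologicalSpace M] [ChartedSpace E M] [IsManifold 𝓘(𝕜, E) ω M]
  {B : Type*} [TopologicalSpace B] [ChartedSpace E' B] [IsManifold 𝓘(𝕜, E') ω B]

/-- Near a point where `w ∘ π` does not vanish, there is an analytic function whose value is the
coefficient of `dπ(Y)` along `w` wherever `dπ(Y)` is a multiple of `w`. -/
theorem exists_coefficient {π : M → B} (hπ : ContMDiff 𝓘(𝕜, E) 𝓘(𝕜, E') ω π)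
    {w : (b : B) → TangentSpace 𝓘(𝕜, E') b} {x₀ : M}
    (hw : ContMDiffAt 𝓘(𝕜, E') 𝓘(𝕜, E').tangent ω
      (fun b => (w b : TangentBundle 𝓘(𝕜, E') B)) (π x₀))
    (hw0 : w (π x₀) ≠ 0) {Y : (x : M) → TangentSpace 𝓘(𝕜, E) x}
    (hY : ContMDiffAt 𝓘(𝕜, E) 𝓘(𝕜, E).tangent ω
      (fun x => (Y x : TangentBundle 𝓘(𝕜, E) M)) x₀) :
    ∃ f : M → 𝕜, ContMDiffAt 𝓘(𝕜, E) 𝓘(𝕜, 𝕜) ω f x₀ ∧ ∀ᶠ y in 𝓝 x₀, w (π y) ≠ 0 ∧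
      ∀ c : 𝕜, mfderiv 𝓘(𝕜, E) 𝓘(𝕜, E') π y (Y y) = c • w (π y) → f y = c := by
  set e := trivializationAt E' (TangentSpace 𝓘(𝕜, E') : B → Type _) (π x₀) with he
  have hmem : π x₀ ∈ e.baseSet := mem_baseSet_trivializationAt E' _ (π x₀)
  have hwe : ContMDiffAt 𝓘(𝕜, E) 𝓘(𝕜, E') ω (fun x => (e ⟨π x, w (π x)⟩).2) x₀ :=
    ContMDiffAt.comp x₀ (g := fun b => (e ⟨b, w b⟩).2) ((Bundle.contMDiffAt_section _).1 hw) (hπ x₀)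
  have hYe : ContMDiffAt 𝓘(𝕜, E) 𝓘(𝕜, E') ω
      (fun x => (e ⟨π x, mfderiv 𝓘(𝕜, E) 𝓘(𝕜, E') π x (Y x)⟩).2) x₀ := by
    have h := ((hπ.contMDiff_tangentMap (m := ω) le_rfl).contMDiffAt).comp x₀ hY
    exact (Bundle.contMDiffAt_totalSpace.1 h).2
  have hne : (e ⟨π x₀, w (π x₀)⟩).2 ≠ 0 := by
    intro h
    apply hw0
    exact (e.continuousLinearEquivAt 𝕜 (π x₀) hmem).map_eq_zero_iff.1 h
  -- The coefficient is a quotient of values of a linear form `φ` in a trivialization of `TB`, with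
  -- `φ` chosen nonzero on `w (π x₀)`, hence on `w` nearby.
  obtain ⟨φ, hφ⟩ := SeparatingDual.exists_ne_zero (R := 𝕜) hne
  have hden := φ.contMDiff.contMDiffAt.comp x₀ hwe
  have hnum := φ.contMDiff.contMDiffAt.comp x₀ hYe
  refine ⟨fun x => φ (e ⟨π x, mfderiv 𝓘(𝕜, E) 𝓘(𝕜, E') π x (Y x)⟩).2 / φ (e ⟨π x, w (π x)⟩).2,
    hnum.div₀ hden hφ, ?_⟩
  filter_upwards [hden.continuousAt.eventually_ne hφ,
    hπ.continuous.continuousAt.eventually (e.open_baseSet.mem_nhds hmem)] with y hy hyb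
  have hlin : ∀ u : TangentSpace 𝓘(𝕜, E') (π y),
      (e ⟨π y, u⟩).2 = e.continuousLinearEquivAt 𝕜 (π y) hyb u := fun _ => rfl
  refine ⟨fun h => hy ?_, fun c hc => ?_⟩
  · simp only [Function.comp_apply, hlin, h, map_zero]
  · simp only [Function.comp_apply] at hy
    rw [hc, hlin (c • _), map_smul, map_smul, smul_eq_mul, ← hlin, mul_div_assoc, div_self hy,
      mul_one]

end Coefficients

/-! ### Enlarging a foliation by a transverse basic direction. -/

section Extension

variable {𝕜 : Type*} [RCLike 𝕜] {E : Type*} [NormedAddCommGroup E] [NormedSpace 𝕜 E]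
  [FiniteDimensional 𝕜 E]
  {E' : Type*} [NormedAddCommGroup E'] [NormedSpace 𝕜 E']
  {M : Type*} [TopologicalSpace M] [ChartedSpace E M] [IsManifold 𝓘(𝕜, E) ω M]
  {B : Type*} [TopologicalSpace B] [ChartedSpace E' B] [IsManifold 𝓘(𝕜, E') ω B]

/-- A version of `exists_coefficient` on an open neighborhood. -/
theorem exists_coefficient_on {π : M → B} (hπ : ContMDiff 𝓘(𝕜, E) 𝓘(𝕜, E') ω π)
    {W : Opens B} {w : (b : B) → TangentSpace 𝓘(𝕜, E') b} (hw : IsAnalyticOn W w)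
    {O : Opens M} {Y : (x : M) → TangentSpace 𝓘(𝕜, E) x} (hY : IsAnalyticOn O Y)
    {x₀ : M} (hx₀ : x₀ ∈ O) (hx₀W : π x₀ ∈ W) (hw0 : w (π x₀) ≠ 0) :
    ∃ (N : Opens M) (f : M → 𝕜), x₀ ∈ N ∧ N ≤ O ∧ ContMDiffOn 𝓘(𝕜, E) 𝓘(𝕜, 𝕜) ω f N ∧
      ∀ y ∈ N, ∀ c : 𝕜, mfderiv 𝓘(𝕜, E) 𝓘(𝕜, E') π y (Y y) = c • w (π y) → f y = c := by
  obtain ⟨f, hf, hfy⟩ := exists_coefficient hπ (ContMDiffOn.contMDiffAt hw (W.isOpen.mem_nhds hx₀W))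
    hw0 (ContMDiffOn.contMDiffAt hY (O.isOpen.mem_nhds hx₀))
  obtain ⟨t, ht, hft⟩ := (contMDiffAt_iff_contMDiffOn_nhds (by simp)).1 hf
  obtain ⟨N, hN, hNo, hxN⟩ := mem_nhds_iff.1 (inter_mem ht (inter_mem hfy (O.isOpen.mem_nhds hx₀)))
  exact ⟨⟨N, hNo⟩, f, hxN, fun y hy => (hN hy).2.2, hft.mono fun y hy => (hN hy).1,
    fun y hy c hc => (hN hy).2.1.2 c hc⟩

theorem IsAnalyticOn.sub {O : Opens M} {Y Z : (x : M) → TangentSpace 𝓘(𝕜, E) x}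
    (hY : IsAnalyticOn O Y) (hZ : IsAnalyticOn O Z) : IsAnalyticOn O (Y - Z) :=
  ContMDiffOn.sub_section hY hZ

theorem IsAnalyticOn.smul {O : Opens M} {f : M → 𝕜} {Y : (x : M) → TangentSpace 𝓘(𝕜, E) x}
    (hf : ContMDiffOn 𝓘(𝕜, E) 𝓘(𝕜, 𝕜) ω f O) (hY : IsAnalyticOn O Y) : IsAnalyticOn O (f • Y) :=
  ContMDiffOn.smul_section hf hY

/-- Bracket of two combinations of sections of `F` with a field `v` that is basic for `F`. -/
theorem mlieBracket_add_smul_mem {F : (x : M) → Submodule 𝕜 (TangentSpace 𝓘(𝕜, E) x)}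
    {O : Opens M} (hF : ∀ Y Z : (x : M) → TangentSpace 𝓘(𝕜, E) x,
      IsSection F O Y → IsSection F O Z → ∀ x ∈ O, mlieBracket 𝓘(𝕜, E) Y Z x ∈ F x)
    {v Y Z : (x : M) → TangentSpace 𝓘(𝕜, E) x} (hv : IsBasic F O v)
    (hY : IsSection F O Y) (hZ : IsSection F O Z) {f g : M → 𝕜}
    (hf : ContMDiffOn 𝓘(𝕜, E) 𝓘(𝕜, 𝕜) ω f O) (hg : ContMDiffOn 𝓘(𝕜, E) 𝓘(𝕜, 𝕜) ω g O)
    {x : M} (hx : x ∈ O) :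
    mlieBracket 𝓘(𝕜, E) (Y + f • v) (Z + g • v) x ∈ F x ⊔ Submodule.span 𝕜 {v x} := by
  have := FiniteDimensional.complete 𝕜 E
  have hO := O.isOpen.mem_nhds hx
  have hfx : MDifferentiableAt 𝓘(𝕜, E) 𝓘(𝕜, 𝕜) f x := (hf.contMDiffAt hO).mdifferentiableAt (by simp)
  have hgx : MDifferentiableAt 𝓘(𝕜, E) 𝓘(𝕜, 𝕜) g x := (hg.contMDiffAt hO).mdifferentiableAt (by simp)
  have hYx := hY.1.mdifferentiableAt hx
  have hZx := hZ.1.mdifferentiableAt hx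
  have hvx := hv.1.mdifferentiableAt hx
  have hfv := (hv.1.smul hf).mdifferentiableAt hx
  have hgv := (hv.1.smul hg).mdifferentiableAt hx
  have hl : ∀ {u}, u ∈ F x → u ∈ F x ⊔ Submodule.span 𝕜 {v x} := fun h => Submodule.mem_sup_left h
  have hr : ∀ c : 𝕜, c • v x ∈ F x ⊔ Submodule.span 𝕜 {v x} := fun c =>
    Submodule.mem_sup_right (Submodule.smul_mem _ _ (Submodule.mem_span_singleton_self _))
  have h1 := hF Y Z hY hZ x hx
  have h2 := hv.2 O le_rfl Y hY x hx
  have h3 := hv.2 O le_rfl Z hZ x hx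
  -- In the Leibniz expansion the terms that differentiate `f` or `g` are multiples of `v`, the
  -- brackets with `v` are in `F` because `v` is basic, and `[v, v] = 0`.
  rw [mlieBracket_add_left hYx hfv, mlieBracket_add_right hZx hgv, mlieBracket_smul_right hgx hvx,
    mlieBracket_smul_left hfx hvx, mlieBracket_add_right hZx hgv, mlieBracket_smul_right hgx hvx,
    mlieBracket_self, mlieBracket_swap_apply (V := Y) (W := v)]
  refine add_mem (add_mem (hl h1) (add_mem (hr _) (hl ?_))) (add_mem (hr _) ?_)
  · exact Submodule.smul_mem _ _ (neg_mem h2)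
  · refine Submodule.smul_mem _ _ (add_mem (hl h3) (add_mem (hr _) ?_))
    simp

/-- A regular foliation tangent to the fibers of `π` and local basic fields that project onto the
same nonvanishing field `w` and agree modulo the foliation span a regular foliation. -/
theorem IsRegularFoliation.sup_span {F : (x : M) → Submodule 𝕜 (TangentSpace 𝓘(𝕜, E) x)}
    {O : Opens M} {n : ℕ} (hF : IsRegularFoliation O F n)
    {π : M → B} (hπ : ContMDiff 𝓘(𝕜, E) 𝓘(𝕜, E') ω π)
    (hFπ : ∀ x ∈ O, ∀ u ∈ F x, mfderiv 𝓘(𝕜, E) 𝓘(𝕜, E') π x u = 0)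
    {W : Opens B} {w : (b : B) → TangentSpace 𝓘(𝕜, E') b} (hw : IsAnalyticOn W w)
    (hw0 : ∀ b ∈ W, w b ≠ 0) (hOW : ∀ x ∈ O, π x ∈ W)
    {κ : Type*} {V : κ → Opens M} (hV : ⨆ k, V k = O)
    {v : κ → (x : M) → TangentSpace 𝓘(𝕜, E) x} (hv : ∀ k, IsBasic F (V k) (v k))
    (hvw : ∀ k, ∀ x ∈ V k, mfderiv 𝓘(𝕜, E) 𝓘(𝕜, E') π x (v k x) = w (π x))
    {G : (x : M) → Submodule 𝕜 (TangentSpace 𝓘(𝕜, E) x)}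
    (hG : ∀ k, ∀ x ∈ V k, G x = F x ⊔ Submodule.span 𝕜 {v k x}) :
    IsRegularFoliation O G (n + 1) := by
  have hcov : ∀ x ∈ O, ∃ k, x ∈ V k := fun x hx => by rwa [← hV, Opens.mem_iSup] at hx
  have hVO : ∀ k, V k ≤ O := fun k => hV ▸ le_iSup V k
  constructor
  · intro x hx
    obtain ⟨k, hk⟩ := hcov x hx
    obtain ⟨N, hxN, hNO, e, he, hspan⟩ := hF.frame x hx
    refine ⟨N ⊓ V k, ⟨hxN, hk⟩, inf_le_left.trans hNO,
      Fin.cons (v k) e, fun i => ?_, fun y hy => ?_⟩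
    · refine Fin.cases ?_ (fun i => ?_) i
      · exact (hv k).1.mono inf_le_right
      · exact (he i).mono inf_le_left
    · have hcons : (fun i => (Fin.cons (v k) e : Fin (n + 1) → _) i y) =
          (Fin.cons (v k y) (fun i => e i y) : Fin (n + 1) → TangentSpace 𝓘(𝕜, E) y) := by
        funext i
        refine Fin.cases rfl (fun i => rfl) i
      obtain ⟨hli, hsp⟩ := hspan y hy.1
      rw [hcons, linearIndependent_finCons, Fin.range_cons, Submodule.span_insert, hsp,
        hG k y hy.2, sup_comm]
      -- The field `v k` is independent of `F` because it projects onto `w ≠ 0` while `F` is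
      -- vertical.
      refine ⟨⟨hli, fun h => hw0 _ (hOW y (hNO hy.1)) ?_⟩, rfl⟩
      rw [← hvw k y hy.2]
      exact hFπ y (hNO hy.1) _ h
  · intro V' hV' Y Z hY hZ x hx
    obtain ⟨k, hk⟩ := hcov x (hV' hx)
    have hxW := hOW x (hV' hx)
    -- Membership in `G` is pointwise; this gives an analytic splitting of a section into a multiple
    -- of `v k` and a section of `F`. Since `dπ` kills the `F`-part, the coefficient is read off on
    -- the base.
    have coef : ∀ Y : (x : M) → TangentSpace 𝓘(𝕜, E) x, IsSection G V' Y →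
        ∃ (N : Opens M) (f : M → 𝕜), x ∈ N ∧ N ≤ V k ∧ ContMDiffOn 𝓘(𝕜, E) 𝓘(𝕜, 𝕜) ω f N ∧
          IsSection F N (Y - f • v k) := by
      intro Y hY
      obtain ⟨N, f, hxN, hNV, hf, hfy⟩ := exists_coefficient_on hπ hw
        (hY.1.mono (inf_le_left : V' ⊓ V k ≤ V')) ⟨hx, hk⟩ hxW (hw0 _ hxW)
      refine ⟨N, f, hxN, hNV.trans inf_le_right, hf,
        (hY.1.mono (hNV.trans inf_le_left)).sub
          (((hv k).1.mono (hNV.trans inf_le_right)).smul hf), fun y hy => ?_⟩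
      have hyV := hNV hy
      have hYy := hY.2 y hyV.1
      rw [hG k y hyV.2] at hYy
      obtain ⟨a, ha, b, hb, hab⟩ := Submodule.mem_sup.1 hYy
      obtain ⟨c, rfl⟩ := Submodule.mem_span_singleton.1 hb
      have hc : f y = c := hfy y hy c (by
        rw [← hab, map_add, hFπ y (hV' hyV.1) a ha, zero_add, map_smul, hvw k y hyV.2])
      have : (Y - f • v k) y = a := by
        rw [Pi.sub_apply, Pi.smul_apply', hc, ← hab, add_sub_cancel_right]
      rwa [this]
    obtain ⟨N₁, f, hx₁, hN₁, hf, hYf⟩ := coef Y hY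
    obtain ⟨N₂, g, hx₂, hN₂, hg, hZg⟩ := coef Z hZ
    have key := mlieBracket_add_smul_mem (O := N₁ ⊓ N₂) (F := F) (v := v k)
      (Y := Y - f • v k) (Z := Z - g • v k) (f := f) (g := g)
      (hF.involutive _ (inf_le_left.trans (hN₁.trans (hVO k))))
      ((hv k).mono (inf_le_left.trans hN₁))
      ⟨hYf.1.mono inf_le_left, fun y hy => hYf.2 y hy.1⟩
      ⟨hZg.1.mono inf_le_right, fun y hy => hZg.2 y hy.2⟩
      (hf.mono fun y hy => hy.1) (hg.mono fun y hy => hy.2) (x := x) ⟨hx₁, hx₂⟩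
    rwa [sub_add_cancel, sub_add_cancel, ← hG k x hk] at key

theorem mlieBracket_eq_zero_of_eventually_eq_zero {Y Z : (x : M) → TangentSpace 𝓘(𝕜, E) x} {x : M}
    (hZ : ∀ᶠ y in 𝓝 x, Z y = 0) : mlieBracket 𝓘(𝕜, E) Y Z x = 0 := by
  have h : Z =ᶠ[𝓝 x] (0 : (x : M) → TangentSpace 𝓘(𝕜, E) x) := hZ
  have e := EventuallyEq.mlieBracket_vectorField_eq (EventuallyEq.refl (𝓝 x) Y) h
  exact e.trans (by rw [mlieBracket_zero_right]; rfl)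

/-- The foliation by points. -/
theorem isRegularFoliation_bot (O : Opens M) :
    IsRegularFoliation O (fun x => (⊥ : Submodule 𝕜 (TangentSpace 𝓘(𝕜, E) x))) 0 where
  frame x hx := ⟨O, hx, le_rfl, Fin.elim0, fun i => i.elim0,
    fun y _ => ⟨linearIndependent_empty_type, by simp⟩⟩
  involutive V _ Y Z hY _ x hx := by
    rw [mlieBracket_swap_apply, mlieBracket_eq_zero_of_eventually_eq_zero, neg_zero]
    · exact zero_mem _
    · filter_upwards [V.isOpen.mem_nhds hx] with y hy using hY.2 y hy

/-- The lines spanned by a nonvanishing analytic vector field form a regular foliation. -/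
theorem isRegularFoliation_lineField {O : Opens M} {w : (x : M) → TangentSpace 𝓘(𝕜, E) x}
    (hw : IsAnalyticOn O w) (hw0 : ∀ x ∈ O, w x ≠ 0) : IsRegularFoliation O (lineField w) 1 := by
  -- A line field is the foliation by points enlarged by `w`, with the identity as projection.
  refine (isRegularFoliation_bot O).sup_span (n := 0) (π := id) contMDiff_id ?_ hw hw0
    (fun x hx => hx) (κ := Unit) (V := fun _ => O) (by simp) (v := fun _ => w)
    (fun _ => ⟨hw, fun V _ Y hY x hx => (Submodule.mem_bot 𝕜).2 ?_⟩) (fun _ x _ => ?_) (fun _ x _ => ?_)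
  · rintro x - u rfl
    exact map_zero _
  · apply mlieBracket_eq_zero_of_eventually_eq_zero
    filter_upwards [V.isOpen.mem_nhds hx] with y hy using hY.2 y hy
  · rw [mfderiv_id]; rfl
  · simp [lineField]

theorem IsRegularFoliation.finrank_eq {F : (x : M) → Submodule 𝕜 (TangentSpace 𝓘(𝕜, E) x)}
    {O : Opens M} {n : ℕ} (hF : IsRegularFoliation O F n) {x : M} (hx : x ∈ O) :
    Module.finrank 𝕜 (F x) = n := by
  obtain ⟨N, hxN, -, e, -, h⟩ := hF.frame x hx
  obtain ⟨hli, hsp⟩ := h x hxN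
  rw [← hsp, finrank_span_eq_card hli, Fintype.card_fin]

end Extension

/-! ### Extensions of the foliation and vanishing of the class. -/

namespace Deformation

variable {𝕜 : Type*} [RCLike 𝕜]
  {E : Type*} [NormedAddCommGroup E] [NormedSpace 𝕜 E] [FiniteDimensional 𝕜 E]
  {E' : Type*} [NormedAddCommGroup E'] [NormedSpace 𝕜 E'] [FiniteDimensional 𝕜 E']
  {M : Type u} [TopologicalSpace M] [ChartedSpace E M] [IsManifold 𝓘(𝕜, E) ω M]
  {B : Type v} [TopologicalSpace B] [ChartedSpace E' B] [IsManifold 𝓘(𝕜, E') ω B]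
  {n : ℕ} (D : Deformation 𝕜 (E := E) (E' := E') M B n)
  {w : (b : B) → TangentSpace 𝓘(𝕜, E') b} {W : Opens B}

/-- The basic Kodaira–Spencer class is zero when there are basic lifts whose differences are
tangent to the foliation. -/
theorem isBasicKSClass_zero_of_lifts (L : D.BasicLifts w W)
    (h : ∀ i j, L.v i - L.v j ∈ D.tangentFields (L.U i ⊓ L.U j)) : D.IsBasicKSClass w W 0 := by
  refine ⟨L, Quotient.sound ⟨L.ι, L.U, fun _ => PUnit.unit, id, fun _ => 0, L.cover,
    fun k => L.cover ▸ le_iSup L.U k, fun _ => le_rfl, fun _ => zero_mem _, fun k l => ?_⟩⟩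
  -- The class equation reads `0 = [cocycle]`, so the zero cocycle comes first and a sign appears.
  have e : (zeroCocycle D.basicNormal (D.preim W)).t PUnit.unit PUnit.unit -
      L.cocycle.t k l - (0 - 0) = -(L.v k - L.v l) := by
    change (0 : (x : M) → TangentSpace 𝓘(𝕜, E) x) - (L.v k - L.v l) - (0 - 0) = _
    abel
  rw [id, id, e]
  exact neg_mem (h k l)

/-- If the basic Kodaira–Spencer class is zero, basic lifts can be chosen so that their differences
are tangent to the foliation. -/
theorem exists_lifts_of_isBasicKSClass_zero (h : D.IsBasicKSClass w W 0) :
    ∃ L : D.BasicLifts w W, ∀ i j, L.v i - L.v j ∈ D.tangentFields (L.U i ⊓ L.U j) := by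
  obtain ⟨L, hL⟩ := h
  obtain ⟨κ, V, ρ, σ, c, hV, -, hVσ, hc, h⟩ := Quotient.exact hL
  -- With this sign convention the corrected lifts are `v + c`; the cochain `c` is basic and
  -- vertical, so they remain basic and keep their projection.
  refine ⟨⟨κ, V, hV, fun k => L.v (σ k) + c k, fun k => ?_, fun k x hx => ?_⟩, fun k l => ?_⟩
  · exact ((L.basic (σ k)).mono (hVσ k)).add (hc k).1
  · have e1 := L.projects (σ k) x (hVσ k hx)
    have e2 := (hc k).2 x hx
    rw [Pi.add_apply, map_add, e1, e2]
    exact add_zero _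
  · have e : L.v (σ k) + c k - (L.v (σ l) + c l) =
        -((0 : (x : M) → TangentSpace 𝓘(𝕜, E) x) - (L.v (σ k) - L.v (σ l)) - (c k - c l)) := by
      abel
    change L.v (σ k) + c k - (L.v (σ l) + c l) ∈ _
    rw [e]
    exact neg_mem (h k l)

/-- The vectors of an extension of rank one more that are vertical are tangent to the
foliation. -/
theorem mem_F_of_vertical {O : Opens M} {G : (x : M) → Submodule 𝕜 (TangentSpace 𝓘(𝕜, E) x)}
    (hG : IsRegularFoliation O G (n + 1)) {x : M} (hx : x ∈ O) (hFG : D.F x ≤ G x)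
    {v : TangentSpace 𝓘(𝕜, E) x} (hvG : v ∈ G x)
    (hv : mfderiv 𝓘(𝕜, E) 𝓘(𝕜, E') D.π x v ≠ 0)
    {u : TangentSpace 𝓘(𝕜, E) x} (huG : u ∈ G x)
    (hu : mfderiv 𝓘(𝕜, E) 𝓘(𝕜, E') D.π x u = 0) : u ∈ D.F x := by
  have : FiniteDimensional 𝕜 (TangentSpace 𝓘(𝕜, E) x) := inferInstanceAs (FiniteDimensional 𝕜 E)
  set K : Submodule 𝕜 (TangentSpace 𝓘(𝕜, E) x) :=
    G x ⊓ LinearMap.ker (mfderiv 𝓘(𝕜, E) 𝓘(𝕜, E') D.π x).toLinearMap with hK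
  -- The vector `v` makes `K` proper in `G x`, so `K` has dimension at most `n`, which is the
  -- dimension of `D.F x ≤ K`.
  have hKG : K < G x := lt_of_le_of_ne inf_le_left fun h => hv (by
    rw [← h] at hvG
    exact hvG.2)
  have h1 := Submodule.finrank_lt_finrank_of_lt hKG
  rw [hG.finrank_eq hx] at h1
  have h2 := D.isFoliation.finrank_eq (x := x) trivial
  have hFK : D.F x = K := Submodule.eq_of_le_of_finrank_le
    (le_inf hFG fun a ha => D.tangent x a ha) (by omega)
  rw [hFK]
  exact ⟨huG, hu⟩

/-- Local sections of an extension `G` that project onto `w`. -/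
theorem exists_section_projectsTo {O : Opens M}
    {G : (x : M) → Submodule 𝕜 (TangentSpace 𝓘(𝕜, E) x)} {d : ℕ}
    (hG : IsRegularFoliation O G d) (hw : IsAnalyticOn W w) (hw0 : ∀ b ∈ W, w b ≠ 0)
    (hOW : O ≤ D.preim W)
    (hGw : ∀ x ∈ O, ∀ u ∈ G x, mfderiv 𝓘(𝕜, E) 𝓘(𝕜, E') D.π x u ∈ lineField w (D.π x))
    {x : M} (hx : x ∈ O) (hsurj : ∃ u ∈ G x, mfderiv 𝓘(𝕜, E) 𝓘(𝕜, E') D.π x u = w (D.π x)) :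
    ∃ (N : Opens M) (v : (x : M) → TangentSpace 𝓘(𝕜, E) x), x ∈ N ∧ N ≤ O ∧
      IsSection G N v ∧ D.ProjectsTo N v w := by
  obtain ⟨N, hxN, hNO, e, he, hspan⟩ := hG.frame x hx
  -- Some frame element is not vertical at `x`, otherwise `G x` could not reach `w ≠ 0`. Dividing it
  -- by its coefficient along `w` gives the lift.
  obtain ⟨i, hi⟩ : ∃ i, mfderiv 𝓘(𝕜, E) 𝓘(𝕜, E') D.π x (e i x) ≠ 0 := by
    by_contra! h
    obtain ⟨u, hu, huw⟩ := hsurj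
    rw [← (hspan x hxN).2] at hu
    have hle : Submodule.span 𝕜 (Set.range fun i => e i x) ≤
        LinearMap.ker (mfderiv 𝓘(𝕜, E) 𝓘(𝕜, E') D.π x).toLinearMap :=
      Submodule.span_le.2 (by rintro _ ⟨i, rfl⟩; exact h i)
    exact hw0 _ (hOW hx) (huw ▸ hle hu)
  have heG : ∀ y ∈ N, e i y ∈ G y := fun y hy =>
    (hspan y hy).2 ▸ Submodule.subset_span (Set.mem_range_self i)
  obtain ⟨N', f, hxN', hN', hf, hfy⟩ := exists_coefficient_on D.analytic hw (he i) hxN (hOW hx)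
    (hw0 _ (hOW hx))
  have hfw : ∀ y ∈ N', mfderiv 𝓘(𝕜, E) 𝓘(𝕜, E') D.π y (e i y) = f y • w (D.π y) := by
    intro y hy
    obtain ⟨c, hc⟩ := Submodule.mem_span_singleton.1 (hGw y (hNO (hN' hy)) _ (heG y (hN' hy)))
    rw [hfy y hy c hc.symm, hc]
  have hfx : f x ≠ 0 := fun h => hi (by rw [hfw x hxN', h, zero_smul])
  obtain ⟨S, hS, hSo, hxS⟩ := mem_nhds_iff.1 ((hf.continuousOn.continuousAt
    (N'.isOpen.mem_nhds hxN')).eventually_ne hfx)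
  refine ⟨N' ⊓ ⟨S, hSo⟩, (fun y => (f y)⁻¹) • e i, ⟨hxN', hxS⟩,
    inf_le_left.trans (hN'.trans hNO), ⟨((he i).mono (inf_le_left.trans hN')).smul ?_,
    fun y hy => Submodule.smul_mem _ _ (heG y (hN' hy.1))⟩, fun y hy => ?_⟩
  · exact (hf.mono fun y hy => hy.1).inv₀ fun y hy => hS hy.2
  · rw [Pi.smul_apply', map_smul, hfw y hy.1, smul_smul, inv_mul_cancel₀ (hS hy.2), one_smul]

/-- Sections of an extension `G` that project onto a field of the base are basic. -/
theorem isBasic_of_isSection {O N : Opens M}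
    {G : (x : M) → Submodule 𝕜 (TangentSpace 𝓘(𝕜, E) x)}
    (hG : IsRegularFoliation O G (n + 1)) (hFG : ∀ x ∈ O, D.F x ≤ G x)
    (hw : IsAnalyticOn W w) (hw0 : ∀ b ∈ W, w b ≠ 0) (hOW : O ≤ D.preim W) (hNO : N ≤ O)
    {v : (x : M) → TangentSpace 𝓘(𝕜, E) x} (hv : IsSection G N v) (hvw : D.ProjectsTo N v w) :
    IsBasic D.F N v := by
  have := FiniteDimensional.complete 𝕜 E
  have := FiniteDimensional.complete 𝕜 E'
  refine ⟨hv.1, fun V hV Y hY x hx => ?_⟩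
  have hxO := hNO (hV hx)
  -- The bracket is in `G` by involutivity. It is vertical because `v` is related to `w` and `Y` to
  -- `0`.
  refine D.mem_F_of_vertical hG hxO (hFG x hxO) (hv.2 x (hV hx)) ?_
    (hG.involutive V (hV.trans hNO) v Y ⟨hv.1.mono hV, fun y hy => hv.2 y (hV hy)⟩
      ⟨hY.1, fun y hy => hFG y (hNO (hV hy)) (hY.2 y hy)⟩ x hx) ?_
  · rw [hvw x (hV hx)]
    exact hw0 _ (hOW hxO)
  · rw [mfderiv_mlieBracket_of_related (v := w) (w := 0) D.analytic
      (hv.1.mdifferentiableAt (hV hx)) (hY.1.mdifferentiableAt hx)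
      (hw.mdifferentiableAt (hOW hxO))
      ((IsAnalyticOn.zero W).mdifferentiableAt (hOW hxO)), mlieBracket_zero_right]
    · rfl
    · filter_upwards [N.isOpen.mem_nhds (hV hx)] with y hy using hvw y hy
    · filter_upwards [V.isOpen.mem_nhds hx] with y hy using D.tangent y _ (hY.2 y hy)

/-- The covering is indexed by the points of `π⁻¹(W)`, with a section of `G` over `w` near each;
their differences are vertical in `G`, hence in `F`. -/
theorem isBasicKSClass_zero_of_extension
    (hw : IsAnalyticOn W w) (hw0 : ∀ b ∈ W, w b ≠ 0)
    {G : (x : M) → Submodule 𝕜 (TangentSpace 𝓘(𝕜, E) x)}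
    (hG : IsRegularFoliation (D.preim W) G (n + 1)) (hFG : ∀ x ∈ D.preim W, D.F x ≤ G x)
    (hGw : ∀ x ∈ D.preim W, ∀ u ∈ G x,
      mfderiv 𝓘(𝕜, E) 𝓘(𝕜, E') D.π x u ∈ lineField w (D.π x))
    (hsurj : ∀ x ∈ D.preim W, ∃ u ∈ G x, mfderiv 𝓘(𝕜, E) 𝓘(𝕜, E') D.π x u = w (D.π x)) :
    D.IsBasicKSClass w W 0 := by
  have h : ∀ x : D.preim W, ∃ (N : Opens M) (v : (x : M) → TangentSpace 𝓘(𝕜, E) x), x.1 ∈ N ∧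
      N ≤ D.preim W ∧ IsSection G N v ∧ D.ProjectsTo N v w := fun x =>
    D.exists_section_projectsTo hG hw hw0 le_rfl hGw x.2 (hsurj x.1 x.2)
  choose N v hxN hN hv hvw using h
  refine D.isBasicKSClass_zero_of_lifts
    ⟨D.preim W, N, le_antisymm (iSup_le hN) fun x hx => Opens.mem_iSup.2 ⟨⟨x, hx⟩, hxN _⟩, v,
      fun i => D.isBasic_of_isSection hG hFG hw hw0 le_rfl (hN i) (hv i) (hvw i), hvw⟩
    fun i j => ⟨((hv i).1.mono inf_le_left).sub ((hv j).1.mono inf_le_right), fun x hx => ?_⟩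
  have hxW := hN i hx.1
  refine D.mem_F_of_vertical hG hxW (hFG x hxW) ((hv i).2 x hx.1) ?_
    (sub_mem ((hv i).2 x hx.1) ((hv j).2 x hx.2)) ?_
  · rw [hvw i x hx.1]
    exact hw0 _ hxW
  · rw [Pi.sub_apply, map_sub, hvw i x hx.1, hvw j x hx.2, sub_self]

theorem isIntegratedBy_of_isBasicKSClass_zero
    (hw : IsAnalyticOn W w) (hw0 : ∀ b ∈ W, w b ≠ 0) (h : D.IsBasicKSClass w W 0) :
    D.IsIntegratedBy W (lineField w) 1 := by
  obtain ⟨L, hL⟩ := D.exists_lifts_of_isBasicKSClass_zero h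
  -- The supremum over all members of the covering that contain `x` avoids choosing one; by `hL` any
  -- single member gives the same space.
  refine ⟨isRegularFoliation_lineField hw hw0, fun b hb => ⟨W, hb, le_rfl,
    fun x => D.F x ⊔ ⨆ (k) (_ : x ∈ L.U k), Submodule.span 𝕜 {L.v k x}, ?_⟩⟩
  have hG : ∀ k, ∀ x ∈ L.U k, (D.F x ⊔ ⨆ (l) (_ : x ∈ L.U l), Submodule.span 𝕜 {L.v l x}) =
      D.F x ⊔ Submodule.span 𝕜 {L.v k x} := by
    intro k x hx
    refine le_antisymm (sup_le le_sup_left (iSup₂_le fun l hl => ?_))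
      (sup_le_sup_left (le_iSup₂ (f := fun l (_ : x ∈ L.U l) => Submodule.span 𝕜 {L.v l x}) k hx) _)
    rw [Submodule.span_singleton_le_iff_mem, ← sub_add_cancel (L.v l x) (L.v k x)]
    exact add_mem (Submodule.mem_sup_left ((hL l k).2 x ⟨hl, hx⟩))
      (Submodule.mem_sup_right (Submodule.mem_span_singleton_self _))
  refine ⟨IsRegularFoliation.sup_span (O := D.preim W)
    ⟨fun x _ => ?_, fun V _ => D.isFoliation.involutive V le_top⟩ D.analytic
    (fun x _ u hu => D.tangent x u hu) hw hw0 (fun x hx => hx) L.cover L.basic L.projects hG,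
    fun x hx => ?_⟩
  · obtain ⟨N, hxN, -, e, he, hspan⟩ := D.isFoliation.frame x trivial
    exact ⟨N ⊓ D.preim W, ⟨hxN, by assumption⟩, inf_le_right, e,
      fun i => (he i).mono inf_le_left, fun y hy => hspan y hy.1⟩
  · obtain ⟨k, hk⟩ : ∃ k, x ∈ L.U k := by rwa [← L.cover, Opens.mem_iSup] at hx
    have hvk := L.projects k x hk
    beta_reduce
    rw [hG k x hk]
    refine ⟨le_sup_left, fun u hu => ?_, fun η hη => ?_⟩
    · obtain ⟨a, ha, b, hb, rfl⟩ := Submodule.mem_sup.1 hu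
      obtain ⟨c, rfl⟩ := Submodule.mem_span_singleton.1 hb
      rw [map_add, D.tangent x a ha, zero_add, map_smul, hvk]
      exact Submodule.smul_mem _ _ (Submodule.mem_span_singleton_self _)
    · obtain ⟨c, rfl⟩ := Submodule.mem_span_singleton.1 hη
      exact ⟨c • L.v k x, Submodule.mem_sup_right
        (Submodule.smul_mem _ _ (Submodule.mem_span_singleton_self _)), by rw [map_smul, hvk]⟩

/-- Allows passing to the locus where `w` does not vanish. -/
theorem IsBasicKSClass.zero_mono {W' : Opens B} (hW : W' ≤ W) (h : D.IsBasicKSClass w W 0) :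
    D.IsBasicKSClass w W' 0 := by
  obtain ⟨L, hL⟩ := D.exists_lifts_of_isBasicKSClass_zero h
  have hp : D.preim W' ≤ D.preim W := fun x hx => hW hx
  refine D.isBasicKSClass_zero_of_lifts ⟨L.ι, fun i => L.U i ⊓ D.preim W', ?_, L.v,
    fun i => (L.basic i).mono inf_le_left, fun i x hx => L.projects i x hx.1⟩ fun i j => ?_
  · rw [← iSup_inf_eq, L.cover, inf_eq_right.2 hp]
  · exact D.basicNormal.den_anti (inf_le_inf inf_le_left inf_le_left) (hL i j)

end Deformation

/-- The nonvanishing clause of `exists_coefficient`, applied with the identity as projection. -/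
theorem isOpen_ne_zero {𝕜 : Type*} [RCLike 𝕜] {E : Type*} [NormedAddCommGroup E] [NormedSpace 𝕜 E]
    {M : Type*} [TopologicalSpace M] [ChartedSpace E M] [IsManifold 𝓘(𝕜, E) ω M] {O : Opens M}
    {w : (x : M) → TangentSpace 𝓘(𝕜, E) x} (hw : IsAnalyticOn O w) :
    IsOpen {x | x ∈ O ∧ w x ≠ 0} := by
  refine isOpen_iff_mem_nhds.2 fun x hx => ?_
  have hwx := ContMDiffOn.contMDiffAt hw (O.isOpen.mem_nhds hx.1)
  obtain ⟨f, -, hf⟩ := exists_coefficient (contMDiff_id (n := ω)) (x₀ := x) hwx hx.2 hwx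
  filter_upwards [hf, O.isOpen.mem_nhds hx.1] with y hy hyO using ⟨hyO, hy.1⟩

end FoliationDeformation

theorem mainTheorem3 {𝕜 : Type*} [RCLike 𝕜]
    {E : Type*} [NormedAddCommGroup E] [NormedSpace 𝕜 E] [FiniteDimensional 𝕜 E]
    {E' : Type*} [NormedAddCommGroup E'] [NormedSpace 𝕜 E'] [FiniteDimensional 𝕜 E']
    {M : Type*} [TopologicalSpace M] [T2Space M] [SecondCountableTopology M]
    [ChartedSpace E M] [IsManifold 𝓘(𝕜, E) ω M]
    {B : Type*} [TopologicalSpace B] [T2Space B] [SecondCountableTopology B]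
    [ChartedSpace E' B] [IsManifold 𝓘(𝕜, E') ω B]
    {n : ℕ} (D : FoliationDeformation.Deformation 𝕜 (E := E) (E' := E') M B n)
    (τ : B) (W : Opens B) (hτ : τ ∈ W)
    (w : (b : B) → TangentSpace 𝓘(𝕜, E') b) (hw : FoliationDeformation.IsAnalyticOn W w)
    (hwτ : w τ ≠ 0) :
    (∃ W' : Opens B, τ ∈ W' ∧ W' ≤ W ∧
        D.IsIntegratedBy W' (FoliationDeformation.lineField w) 1) ↔
      D.BasicKSVanishesAt w W τ := by
  constructor
  · rintro ⟨W', hτ', hW', hline, hint⟩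
    obtain ⟨U, hτU, hU, G, hG, hGx⟩ := hint τ hτ'
    refine ⟨U, hτU, hU.trans hW', D.isBasicKSClass_zero_of_extension (hw.mono (hU.trans hW'))
      (fun b hb h0 => ?_) hG (fun x hx => (hGx x hx).1) (fun x hx => (hGx x hx).2.1)
      fun x hx => (hGx x hx).2.2 _ (Submodule.mem_span_singleton_self _)⟩
    -- The line field has rank one on all of `U`, which forces `w ≠ 0` there and not only at `τ`.
    have h := hline.finrank_eq (hU hb)
    rw [FoliationDeformation.lineField, h0, Submodule.span_zero_singleton, finrank_bot] at h
    exact zero_ne_one h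
  · rintro ⟨W', hτ', hW', h⟩
    let W₀ : Opens B := ⟨_, FoliationDeformation.isOpen_ne_zero (hw.mono hW')⟩
    have hW₀ : W₀ ≤ W' := fun b hb => hb.1
    exact ⟨W₀, ⟨hτ', hwτ⟩, hW₀.trans hW', D.isIntegratedBy_of_isBasicKSClass_zero
      (hw.mono (hW₀.trans hW')) (fun b hb => hb.2)
      (FoliationDeformation.Deformation.IsBasicKSClass.zero_mono D hW₀ h)⟩
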